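/- For $n\ge 1$ consider $n$ pairs of cards labelled $1,\dots,n$, each pair consisting of a blue and a red card with the same label. A game of size $n$ is a permutation of these $2n$ cards in which, for every label, the blue card precedes the red card. The $n$ red cards split the game into $n$ blocks of consecutive cards: the first block consists of the cards up to and including the first red card, and for $2\le i\le n$ the $i$-th block consists of the cards after the $(i-1)$-st red card up to and including the $i$-th red card. Let $D_{n,i}$ be the length (number of cards) of the $i$-th block in a uniformly random game of size $n$. Then for every fixed integer $k\ge 1$, as $n\to\infty$, \[ \left(\frac{D_{n,1}}{2\sqrt n},\dots,\frac{D_{n,k}}{2\sqrt n}\right)\stackrel{d}{\longrightarrow}(X_1,\dots,X_k), \] where $(X_1,\dots,X_k)$ is a random vector with joint probability density function (with respect to Lebesgue measure on $\mathbb R^k$) \[ f(x_1,\dots,x_k)=\begin{cases}2^k\,x_1(x_1+x_2)\cdots(x_1+\cdots+x_k)\,e^{-(x_1+\cdots+x_k)^2} & \text{if } x_1,\dots,x_k\ge 0,\\ 0&\text{otherwise.}\end{cases} \] In particular, $f$ is a probability density. -/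

import Mathlib

open MeasureTheory Filter

noncomputable section

namespace MemoryGame

/-- The `2n` cards of a game of size `n`: a card is a label together with a colour,
where `false` is blue and `true` is red. -/
abbrev Card (n : ℕ) : Type := Fin n × Bool

/-- A game with `n` pairs of cards: a permutation of the `2n` cards (`σ p` is the card at
position `p`) in which every blue card precedes the red card with the same label. -/
def Deal (n : ℕ) : Type :=
  {σ : Fin (2 * n) ≃ Card n // ∀ a : Fin n, σ.symm (a, false) < σ.symm (a, true)}

instance (n : ℕ) : Fintype (Deal n) :=
  inferInstanceAs (Fintype
    {σ : Fin (2 * n) ≃ Card n // ∀ a : Fin n, σ.symm (a, false) < σ.symm (a, true)})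

instance (n : ℕ) : Nonempty (Deal n) := by
  let e : Card n ≃ Fin (2 * n) :=
    ((Equiv.refl (Fin n)).prodCongr finTwoEquiv.symm).trans
      (finProdFinEquiv.trans (finCongr (Nat.mul_comm n 2)))
  refine ⟨⟨e.symm, fun a => ?_⟩⟩
  simp [e, Fin.lt_def, finTwoEquiv]

/-- Every event is measurable. -/
instance (n : ℕ) : MeasurableSpace (Deal n) := ⊤

/-- The uniform distribution on the games with `n` pairs of cards. -/
def randomGame (n : ℕ) : Measure (Deal n) :=
  (PMF.uniformOfFintype (Deal n)).toMeasure

instance (n : ℕ) : IsProbabilityMeasure (randomGame n) :=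
  inferInstanceAs (IsProbabilityMeasure (PMF.uniformOfFintype (Deal n)).toMeasure)

/-- The position `p` carries a red card. -/
def Deal.IsRed {n : ℕ} (σ : Deal n) (p : Fin (2 * n)) : Prop := (σ.1 p).2 = true

instance {n : ℕ} (σ : Deal n) (p : Fin (2 * n)) : Decidable (σ.IsRed p) :=
  inferInstanceAs (Decidable ((σ.1 p).2 = true))

/-- The block with index `i` (counted from `0`): the positions that have exactly `i` red cards
strictly before them. For `i < n` these are the consecutive positions after the `i`-th red card
(from the start, if `i = 0`), up to and including the `(i + 1)`-st red card; for `n ≤ i`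
there are none. -/
def Deal.block {n : ℕ} (σ : Deal n) (i : ℕ) : Finset (Fin (2 * n)) :=
  {p | (Finset.univ.filter fun q => q < p ∧ σ.IsRed q).card = i}

/-- The length of the block with index `i` (counted from `0`). -/
def Deal.blockLength {n : ℕ} (σ : Deal n) (i : ℕ) : ℕ := (σ.block i).card

/-- The lengths of the first `k` blocks, divided by `2√n`. -/
def scaledBlockLengths (k n : ℕ) (σ : Deal n) : Fin k → ℝ :=
  fun i => (σ.blockLength i : ℝ) / (2 * √(n : ℝ))

open Classical in
/-- The function `2^k x₁ (x₁ + x₂) ⋯ (x₁ + ⋯ + x_k) exp (-(x₁ + ⋯ + x_k)²)` on the orthant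
of vectors with nonnegative coordinates, and `0` elsewhere. -/
def limitDensity (k : ℕ) (x : Fin k → ℝ) : ℝ :=
  if ∀ i, 0 ≤ x i then
    2 ^ k * (∏ i : Fin k, ∑ j ∈ Finset.Iic i, x j) * Real.exp (-(∑ j, x j) ^ 2)
  else 0

/-- The measure on `ℝᵏ` with density `limitDensity k` with respect to Lebesgue measure. -/
def limitLaw (k : ℕ) : Measure (Fin k → ℝ) :=
  volume.withDensity fun x => ENNReal.ofReal (limitDensity k x)

end MemoryGame

end

/-!
Forget the colours: a uniformly random game is a uniformly random arrangement of `2n` cards, where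
the second card of each pair is declared red. In an arrangement drawn card by card, if `t` cards
have been drawn and `c` pairs completed, then by exchangeability of the remaining positions the
next card completes a pair with probability `(t - 2c) / (2n - t)`. Multiplying these probabilities
gives the exact joint distribution of the first `k` block lengths. With the partial sums of the
lengths equal to `2√n (x₁ + ⋯ + xᵢ)`, the completing cards contribute the factors
`2 (x₁ + ⋯ + xᵢ)` of the density, and what remains is a ratio of two birthday probabilities, with
limit `exp (-(x₁ + ⋯ + xₖ)²)`. By Fatou's lemma, this pointwise convergence to a probability density
implies convergence in distribution.
-/

open scoped Topology ENNReal Finset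

section LocalLimit

variable {ι : Type*} [Fintype ι] {s : ℝ}

lemma volume_floor_fiber (hs : 0 < s) (m : ι → ℤ) :
    volume {x : ι → ℝ | (fun i => ⌊s * x i⌋) = m} = ENNReal.ofReal (s ^ Fintype.card ι)⁻¹ := by
  have hcell : {x : ι → ℝ | (fun i => ⌊s * x i⌋) = m} =
      Set.univ.pi fun i => Set.Ico (m i / s) ((m i + 1) / s) := by
    ext x
    simp [funext_iff, Int.floor_eq_iff, Set.mem_pi, div_le_iff₀ hs, lt_div_iff₀ hs, mul_comm s]
  have hside (i : ι) : (m i + 1) / s - m i / s = s⁻¹ := by ring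
  rw [hcell, Real.volume_pi_Ico]
  simp only [hside, Finset.prod_const, Finset.card_univ]
  rw [← ENNReal.ofReal_pow (by positivity), inv_pow]

lemma lintegral_comp_floor (hs : 0 < s) (φ : (ι → ℤ) → ℝ≥0∞) :
    ∫⁻ x : ι → ℝ, ENNReal.ofReal (s ^ Fintype.card ι) * φ (fun i => ⌊s * x i⌋) = ∑' m, φ m := by
  have hfloor : Measurable fun (x : ι → ℝ) i => ⌊s * x i⌋ := by fun_prop
  have hφ : Measurable φ := .of_discrete
  have hφfloor : Measurable fun x : ι → ℝ => φ fun i => ⌊s * x i⌋ := hφ.comp hfloor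
  rw [lintegral_const_mul _ hφfloor, ← lintegral_map hφ hfloor, lintegral_countable',
    ← ENNReal.tsum_mul_left]
  refine tsum_congr fun m => ?_
  rw [Measure.map_apply hfloor (measurableSet_singleton m)]
  change ENNReal.ofReal _ * (φ m * volume {x : ι → ℝ | (fun i => ⌊s * x i⌋) = m}) = φ m
  rw [volume_floor_fiber hs, mul_left_comm, ← ENNReal.ofReal_mul (by positivity),
    mul_inv_cancel₀ (by positivity), ENNReal.ofReal_one, mul_one]

variable {Ω : Type*} [MeasurableSpace Ω] {P : Measure Ω} {D : Ω → ι → ℤ}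

lemma lintegral_indicator_mul_floor_fiber (hD : Measurable D) (hs : 0 < s) (G : Set (ι → ℝ)) :
    ∫⁻ x : ι → ℝ, ENNReal.ofReal (s ^ Fintype.card ι) *
      G.indicator (fun _ => P {ω | ∀ i, D ω i = ⌊s * x i⌋}) (fun i => ⌊s * x i⌋ / s) =
      P {ω | (fun i => (D ω i : ℝ) / s) ∈ G} := by
  classical
  let A : Set (ι → ℤ) := {m | (fun i => (m i : ℝ) / s) ∈ G}
  have hcell (m : ι → ℤ) : G.indicator (fun _ => P {ω | ∀ i, D ω i = m i}) (fun i => m i / s) =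
      A.indicator 1 m * P.map D {m} := by
    rw [Measure.map_apply hD (measurableSet_singleton m)]
    simp [Set.indicator_apply, A, Set.preimage, funext_iff]
  calc _ = ∑' m, A.indicator 1 m * P.map D {m} := by
        rw [← lintegral_comp_floor hs]
        simp only [← hcell]
    _ = P.map D A := by
        rw [← lintegral_countable', lintegral_indicator_one A.to_countable.measurableSet]
    _ = _ := Measure.map_apply hD A.to_countable.measurableSet

end LocalLimit

lemma tendsto_floor_mul_div {α : Type*} {l : Filter α} {s : α → ℝ} (hs : Tendsto s l atTop)
    (x : ℝ) : Tendsto (fun a => (⌊s a * x⌋ : ℝ) / s a) l (𝓝 x) := by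
  have hlower : Tendsto (fun a => x - 1 / s a) l (𝓝 x) := by
    simpa using (hs.const_div_atTop 1).const_sub x
  refine tendsto_of_tendsto_of_tendsto_of_le_of_le' hlower tendsto_const_nhds ?_ ?_
  all_goals filter_upwards [hs.eventually_gt_atTop 0] with a ha
  · rw [le_div_iff₀ ha, sub_mul, one_div_mul_cancel ha.ne', mul_comm x]
    exact (Int.sub_one_lt_floor _).le
  · rw [div_le_iff₀ ha, mul_comm x]
    exact Int.floor_le _

/-- Fatou's lemma, applied to the lattice cells as functions of the point `x`, gives the lower
bound for open sets in the portmanteau theorem. -/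
theorem tendstoInDistribution_of_local_limit {ι α : Type*} [Fintype ι] {l : Filter α}
    [l.NeBot] [l.IsCountablyGenerated] {Ω : α → Type*} [∀ a, MeasurableSpace (Ω a)]
    {P : ∀ a, Measure (Ω a)} [∀ a, IsProbabilityMeasure (P a)] {D : ∀ a, Ω a → ι → ℤ}
    (hD : ∀ a, Measurable (D a)) {s : α → ℝ} (hs : Tendsto s l atTop) {f : (ι → ℝ) → ℝ}
    [IsProbabilityMeasure (volume.withDensity fun x => ENNReal.ofReal (f x))]
    (hlocal : ∀ᵐ x, Tendsto (fun a => s a ^ Fintype.card ι *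
      (P a).real {ω | ∀ i, D a ω i = ⌊s a * x i⌋}) l (𝓝 (f x))) :
    TendstoInDistribution (fun a ω i => (D a ω i : ℝ) / s a) l id P
      (volume.withDensity fun x => ENNReal.ofReal (f x)) := by
  have hmeas (a : α) : Measurable fun ω i => (D a ω i : ℝ) / s a := by
    have := hD a
    fun_prop
  refine ⟨fun a => (hmeas a).aemeasurable, aemeasurable_id, ?_⟩
  refine tendsto_of_forall_isOpen_le_liminf' fun G hG => ?_
  simp only [ProbabilityMeasure.coe_mk, Measure.map_id,
    Measure.map_apply (hmeas _) hG.measurableSet]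
  let φ (a : α) (x : ι → ℝ) : ℝ≥0∞ := ENNReal.ofReal (s a ^ Fintype.card ι) *
    G.indicator (fun _ => P a {ω | ∀ i, D a ω i = ⌊s a * x i⌋}) (fun i => ⌊s a * x i⌋ / s a)
  have hφ (a : α) : Measurable (φ a) := by
    let ψ (m : ι → ℤ) : ℝ≥0∞ := ENNReal.ofReal (s a ^ Fintype.card ι) *
      G.indicator (fun _ => P a {ω | ∀ i, D a ω i = m i}) (fun i => m i / s a)
    exact (show Measurable ψ by fun_prop).comp (by fun_prop)
  have hle : ∀ᵐ x, G.indicator (fun x => ENNReal.ofReal (f x)) x ≤ liminf (φ · x) l := by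
    filter_upwards [hlocal] with x hx
    by_cases hxG : x ∈ G
    swap
    · simp [hxG]
    rw [Set.indicator_of_mem hxG]
    have hmem : ∀ᶠ a in l, (fun i => (⌊s a * x i⌋ : ℝ) / s a) ∈ G :=
      (tendsto_pi_nhds.2 fun i => tendsto_floor_mul_div hs (x i)).eventually (hG.mem_nhds hxG)
    refine ((ENNReal.tendsto_ofReal hx).congr' ?_).liminf_eq.ge
    filter_upwards [hmem, hs.eventually_ge_atTop 0] with a ha hsa
    rw [ENNReal.ofReal_mul (by positivity), ofReal_measureReal]
    simp only [φ, Set.indicator_of_mem ha]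
  calc _ = ∫⁻ x, G.indicator (fun x => ENNReal.ofReal (f x)) x := by
        rw [withDensity_apply _ hG.measurableSet, lintegral_indicator hG.measurableSet]
    _ ≤ ∫⁻ x, liminf (φ · x) l := lintegral_mono_ae hle
    _ ≤ liminf (fun a => ∫⁻ x, φ a x) l := lintegral_liminf_le hφ
    _ = _ := by
        refine liminf_congr ?_
        filter_upwards [hs.eventually_gt_atTop 0] with a ha
        exact lintegral_indicator_mul_floor_fiber (hD a) ha G

section Birthday

lemma cast_descFactorial_div_pow {N t : ℕ} (ht : t < N) :
    (N.descFactorial t : ℝ) / N ^ t = ∏ p ∈ Finset.range t, (1 - (p : ℝ) / N) := by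
  have hN : (N : ℝ) ≠ 0 := by exact_mod_cast (Nat.zero_lt_of_lt ht).ne'
  have hpow : (N : ℝ) ^ t = ∏ _p ∈ Finset.range t, (N : ℝ) := by simp
  rw [Nat.descFactorial_eq_prod_range, Nat.cast_prod, hpow, ← Finset.prod_div_distrib]
  refine Finset.prod_congr rfl fun p hp => ?_
  have hpt := Finset.mem_range.1 hp
  rw [Nat.cast_sub (by omega), sub_div, div_self hN]

lemma prod_range_exp_neg_div (t : ℕ) (b : ℝ) :
    ∏ p ∈ Finset.range t, Real.exp (-(p / b)) = Real.exp (-(t * (t - 1) / 2 / b)) := by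
  have hsum : ∑ p ∈ Finset.range t, (p : ℝ) = t * (t - 1) / 2 := by
    induction t with
    | zero => simp
    | succ t ih => rw [Finset.sum_range_succ, ih]; push_cast; ring
  rw [← Real.exp_sum, Finset.sum_neg_distrib, ← Finset.sum_div, hsum]

lemma exp_neg_div_sub_le_one_sub_div {a b : ℝ} (ha : 0 ≤ a) (hab : a < b) :
    Real.exp (-(a / (b - a))) ≤ 1 - a / b := by
  have hpos : 0 < b - a := sub_pos.2 hab
  have hb : 0 < b := ha.trans_lt hab
  rw [Real.exp_neg]
  calc (Real.exp (a / (b - a)))⁻¹ ≤ (a / (b - a) + 1)⁻¹ := by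
        gcongr
        exact Real.add_one_le_exp _
    _ = 1 - a / b := by
        field_simp
        ring

lemma descFactorial_div_pow_le {N t : ℕ} (ht : t < N) :
    (N.descFactorial t : ℝ) / N ^ t ≤ Real.exp (-(t * (t - 1) / 2 / N)) := by
  rw [cast_descFactorial_div_pow ht, ← prod_range_exp_neg_div]
  refine Finset.prod_le_prod (fun p hp => ?_) fun p _ => Real.one_sub_le_exp_neg _
  have hpN : p ≤ N := ((Finset.mem_range.1 hp).trans ht).le
  rw [sub_nonneg]
  exact div_le_one_of_le₀ (by exact_mod_cast hpN) N.cast_nonneg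

lemma le_descFactorial_div_pow {N t : ℕ} (ht : t < N) :
    Real.exp (-(t * (t - 1) / 2 / (N - t))) ≤ (N.descFactorial t : ℝ) / N ^ t := by
  rw [cast_descFactorial_div_pow ht, ← prod_range_exp_neg_div]
  refine Finset.prod_le_prod (fun p _ => (Real.exp_pos _).le) fun p hp => ?_
  have hpt : (p : ℝ) ≤ t := by exact_mod_cast (Finset.mem_range.1 hp).le
  have htN : (t : ℝ) < N := by exact_mod_cast ht
  have : (0 : ℝ) < N - t := sub_pos.2 htN
  refine le_trans ?_ (exp_neg_div_sub_le_one_sub_div p.cast_nonneg (hpt.trans_lt htN))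
  gcongr

variable {α : Type*} {l : Filter α} {N t : α → ℕ} {c : ℝ}

lemma tendsto_sqrt_natCast_atTop (hN : Tendsto N l atTop) :
    Tendsto (fun a => √(N a : ℝ)) l atTop :=
  Real.tendsto_sqrt_atTop.comp (tendsto_natCast_atTop_atTop.comp hN)

lemma tendsto_div_zero_of_tendsto_div_sqrt (hN : Tendsto N l atTop)
    (ht : Tendsto (fun a => (t a : ℝ) / √(N a : ℝ)) l (𝓝 c)) :
    Tendsto (fun a => (t a : ℝ) / N a) l (𝓝 0) := by
  refine (ht.div_atTop (tendsto_sqrt_natCast_atTop hN)).congr fun a => ?_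
  rw [div_div, Real.mul_self_sqrt (N a).cast_nonneg]

lemma eventually_lt_of_tendsto_div_sqrt (hN : Tendsto N l atTop)
    (ht : Tendsto (fun a => (t a : ℝ) / √(N a : ℝ)) l (𝓝 c)) : ∀ᶠ a in l, t a < N a := by
  have hratio := tendsto_div_zero_of_tendsto_div_sqrt hN ht
  filter_upwards [hratio.eventually (gt_mem_nhds one_pos), hN.eventually_gt_atTop 0] with a ha hNa
  rw [div_lt_one (by exact_mod_cast hNa)] at ha
  exact_mod_cast ha

/-- The asymptotics of the birthday problem: the probability that `t` independent uniform samples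
from `N` values are distinct. -/
lemma tendsto_descFactorial_div_pow (hN : Tendsto N l atTop)
    (ht : Tendsto (fun a => (t a : ℝ) / √(N a : ℝ)) l (𝓝 c)) :
    Tendsto (fun a => ((N a).descFactorial (t a) : ℝ) / (N a : ℝ) ^ t a) l
      (𝓝 (Real.exp (-(c ^ 2 / 2)))) := by
  have hratio := tendsto_div_zero_of_tendsto_div_sqrt hN ht
  have hlt := eventually_lt_of_tendsto_div_sqrt hN ht
  have hexponent : Tendsto (fun a => (t a : ℝ) * (t a - 1) / 2 / N a) l (𝓝 (c ^ 2 / 2)) := by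
    have hlim := (ht.mul (ht.sub ((tendsto_sqrt_natCast_atTop hN).const_div_atTop 1))).div_const 2
    rw [sub_zero, ← sq] at hlim
    refine hlim.congr fun a => ?_
    rw [← sub_div, div_mul_div_comm, Real.mul_self_sqrt (N a).cast_nonneg, div_right_comm]
  have hexponent' : Tendsto (fun a => (t a : ℝ) * (t a - 1) / 2 / (N a - t a)) l
      (𝓝 (c ^ 2 / 2)) := by
    have hlim := hexponent.div (hratio.const_sub 1) (by norm_num)
    rw [sub_zero, div_one] at hlim
    refine hlim.congr' ?_
    filter_upwards [hN.eventually_gt_atTop 0] with a ha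
    have hNa : (N a : ℝ) ≠ 0 := by exact_mod_cast ha.ne'
    rw [Pi.div_apply, div_div _ (N a : ℝ), mul_one_sub, mul_div_cancel₀ _ hNa]
  refine tendsto_of_tendsto_of_tendsto_of_le_of_le'
    ((Real.continuous_exp.tendsto _).comp hexponent'.neg)
    ((Real.continuous_exp.tendsto _).comp hexponent.neg) ?_ ?_
  · filter_upwards [hlt] with a ha using le_descFactorial_div_pow ha
  · filter_upwards [hlt] with a ha using descFactorial_div_pow_le ha

end Birthday

lemma card_crossing_add_two_mul {α : Type*} [LinearOrder α] [LocallyFiniteOrderBot α]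
    [LocallyFiniteOrderTop α] {π : α → α} (hπ : π.Involutive) (hfix : ∀ z, π z ≠ z) (a : α) :
    #{z ∈ Finset.Ici a | π z < a} + 2 * #{z ∈ Finset.Iio a | π z < z} = #(Finset.Iio a) := by
  have hcross : #{z ∈ Finset.Ici a | π z < a} = #{z ∈ Finset.Iio a | a ≤ π z} :=
    Finset.card_equiv (hπ.toPerm π) fun z => by simp [hπ z, and_comm]
  have hopen : #{z ∈ Finset.Iio a | π z < z} = #{z ∈ Finset.Iio a | π z < a ∧ z < π z} := by
    refine Finset.card_equiv (hπ.toPerm π) fun z => ?_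
    have h (hz : π z < z) : π z < a ∧ z < a ↔ z < a := and_iff_right_of_imp hz.trans
    simp +contextual [hπ z, ← and_assoc, h]
  have hsplit : #{z ∈ Finset.Iio a | π z < a ∧ z < π z} + #{z ∈ Finset.Iio a | π z < z} =
      #{z ∈ Finset.Iio a | π z < a} := by
    rw [← Finset.card_filter_add_card_filter_not (s := {z ∈ Finset.Iio a | π z < a})
      fun z => z < π z, Finset.filter_filter, Finset.filter_filter]
    congr 2
    refine Finset.filter_congr fun z hz => ?_
    rw [not_lt, (hfix z).le_iff_lt]
    exact (and_iff_right_of_imp fun h => h.trans (Finset.mem_Iio.1 hz)).symm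
  have hsides := Finset.card_filter_add_card_filter_not (s := Finset.Iio a) fun z => a ≤ π z
  simp only [not_le] at hsides
  omega

lemma card_filter_Iio_val {N : ℕ} (P : ℕ → Prop) [DecidablePred P] (t : Fin N) :
    #{z ∈ Finset.Iio t | P (z : Fin N)} = Nat.count P t := by
  rw [Nat.count_eq_card_filter_range, ← Nat.Iio_eq_range, ← Fin.map_valEmbedding_Iio,
    Finset.filter_map, Finset.card_map]
  rfl

lemma card_filter_univ_val {N : ℕ} (P : ℕ → Prop) [DecidablePred P] :
    #{z : Fin N | P z} = #{p ∈ Finset.range N | P p} := by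
  rw [← Nat.Iio_eq_range, ← Fin.map_valEmbedding_univ, Finset.filter_map, Finset.card_map]
  rfl

lemma cast_descFactorial_succ {R : Type*} [CommRing R] (N t : ℕ) :
    (N.descFactorial (t + 1) : R) = N.descFactorial t * (N - t) := by
  rw [← descPochhammer_eval_eq_descFactorial, descPochhammer_succ_eval,
    descPochhammer_eval_eq_descFactorial]

lemma swap_apply_lt_iff {α : Type*} [LinearOrder α] {a b t : α} (ha : t ≤ a) (hb : t ≤ b)
    (z : α) : Equiv.swap a b z < t ↔ z < t := by
  rw [Equiv.swap_apply_def]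
  split_ifs with hza hzb
  · simp [hza, ha.not_gt, hb.not_gt]
  · simp [hzb, ha.not_gt, hb.not_gt]
  · rfl

lemma lt_card_filter_range_iff {N q : ℕ} {P : ℕ → Prop} [DecidablePred P]
    (hP : ∀ ⦃p q⦄, p ≤ q → P q → P p) (hq : q < N) : q < #{p ∈ Finset.range N | P p} ↔ P q := by
  constructor
  · contrapose!
    intro hPq
    refine (Finset.card_le_card fun p hp => ?_).trans_eq (Finset.card_range q)
    rw [Finset.mem_range]
    exact lt_of_not_ge fun hqp => hPq (hP hqp (Finset.mem_filter.1 hp).2)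
  · intro hPq
    refine (Finset.card_range (q + 1)).symm.trans_le (Finset.card_le_card fun p hp => ?_)
    have hpq := Finset.mem_range_succ_iff.1 hp
    exact Finset.mem_filter.2 ⟨Finset.mem_range.2 (hpq.trans_lt hq), hP hpq hPq⟩

lemma count_lt_iff_of_card_count_eq {c : ℕ → Prop} [DecidablePred c] {S : ℕ → ℕ}
    (hS0 : S 0 = 0) {k N : ℕ}
    (hcard : ∀ i < k, S i + #{p ∈ Finset.range N | Nat.count c p = i} = S (i + 1))
    {j q : ℕ} (hj : j ≤ k) (hq : q < N) : Nat.count c q < j ↔ q < S j := by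
  have hlower : #{p ∈ Finset.range N | Nat.count c p < j} = S j := by
    clear hq
    induction j with
    | zero => simp [hS0]
    | succ j ih =>
      rw [← hcard j hj, ← ih (by omega), ← Finset.card_union_of_disjoint, ← Finset.filter_or]
      · simp only [Nat.lt_succ_iff_lt_or_eq]
      · exact Finset.disjoint_filter.2 fun p _ => ne_of_lt
  rw [← hlower, lt_card_filter_range_iff (fun p q hpq => (Nat.count_monotone c hpq).trans_lt) hq]

lemma extend_val_of_le {β : Type*} {k i : ℕ} (g : Fin k → β) (e : ℕ → β) (hi : k ≤ i) :
    Function.extend Fin.val g e i = e i :=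
  Function.extend_apply' _ _ _ fun ⟨j, hj⟩ => hi.not_gt (hj ▸ j.2)

/-- The (0-based) position `p` is the last one of a block, when the first `i` blocks have total
length `S i`. -/
def IsBlockEnd (S : ℕ → ℕ) (p : ℕ) : Prop := ∃ i, S (i + 1) = p + 1

section IsBlockEnd

variable {S : ℕ → ℕ}

lemma isBlockEnd_iff (hS : StrictMono S) {j p : ℕ} (hjp : S j ≤ p) (hpj : p < S (j + 1)) :
    IsBlockEnd S p ↔ S (j + 1) = p + 1 := by
  refine ⟨fun ⟨i, hi⟩ => ?_, fun h => ⟨j, h⟩⟩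
  have hij : i + 1 ≤ j + 1 := hS.le_iff_le.1 (by omega)
  have hji : j < i + 1 := hS.lt_iff_lt.1 (by omega)
  obtain rfl : i = j := by omega
  exact hi

section Count

variable [DecidablePred (IsBlockEnd S)]

lemma count_isBlockEnd_bounds (hS : StrictMono S) (hS0 : S 0 = 0) (p : ℕ) :
    S (Nat.count (IsBlockEnd S) p) ≤ p ∧ p < S (Nat.count (IsBlockEnd S) p + 1) := by
  induction p with
  | zero => simpa [hS0] using hS Nat.zero_lt_one
  | succ p ih =>
    rw [Nat.count_succ]
    split_ifs with hp
    · have hend := (isBlockEnd_iff hS ih.1 ih.2).1 hp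
      exact ⟨hend.le, hend ▸ hS (Nat.lt_add_one _)⟩
    · have hend := mt (isBlockEnd_iff hS ih.1 ih.2).2 hp
      rw [add_zero]
      omega

lemma count_isBlockEnd_lt_iff (hS : StrictMono S) (hS0 : S 0 = 0) {j p : ℕ} :
    Nat.count (IsBlockEnd S) p < j ↔ p < S j := by
  obtain ⟨hle, hlt⟩ := count_isBlockEnd_bounds hS hS0 p
  exact ⟨fun h => hlt.trans_le (hS.monotone h), fun h => hS.lt_iff_lt.1 (hle.trans_lt h)⟩

lemma count_isBlockEnd_eq (hS : StrictMono S) (hS0 : S 0 = 0) {j p : ℕ} (hjp : S j ≤ p)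
    (hpj : p < S (j + 1)) : Nat.count (IsBlockEnd S) p = j := by
  rw [← count_isBlockEnd_lt_iff hS hS0] at hpj
  rw [← not_lt, ← count_isBlockEnd_lt_iff hS hS0] at hjp
  omega

end Count

lemma nth_isBlockEnd (hS : StrictMono S) (hS0 : S 0 = 0) (i : ℕ) :
    Nat.nth (IsBlockEnd S) i + 1 = S (i + 1) := by
  classical
  have hlt : S i < S (i + 1) := hS (Nat.lt_add_one i)
  have hend : IsBlockEnd S (S (i + 1) - 1) := ⟨i, by omega⟩
  have hcount := count_isBlockEnd_eq hS hS0 (Nat.le_sub_one_of_lt hlt) (by omega)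
  have hnth := Nat.nth_count hend
  rw [hcount] at hnth
  omega

variable {c : ℕ → Prop} [DecidablePred c] {k N : ℕ}

lemma iff_isBlockEnd_of_card_count_eq (hS : StrictMono S) (hS0 : S 0 = 0) (hN : S k < N)
    (hcard : ∀ i < k, S i + #{p ∈ Finset.range N | Nat.count c p = i} = S (i + 1)) {p : ℕ}
    (hp : p < S k) : c p ↔ IsBlockEnd S p := by
  have hlt {j q : ℕ} (hj : j ≤ k) (hq : q < N) := count_lt_iff_of_card_count_eq hS0 hcard hj hq
  have hcount : Nat.count c p < k := (hlt le_rfl (hp.trans hN)).2 hp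
  have hle : S (Nat.count c p) ≤ p := not_lt.1 <| mt (hlt hcount.le (hp.trans hN)).2 (lt_irrefl _)
  have hlt' : p < S (Nat.count c p + 1) := (hlt hcount (hp.trans hN)).1 (Nat.lt_add_one _)
  have hsucc := hlt (j := Nat.count c p + 1) (q := p + 1) hcount (by omega)
  rw [isBlockEnd_iff hS hle hlt', ← Nat.count_lt_count_succ_iff (p := c)]
  omega

lemma card_count_eq_of_iff_isBlockEnd (hS : StrictMono S) (hS0 : S 0 = 0) (hN : S k ≤ N)
    (hpattern : ∀ p < S k, c p ↔ IsBlockEnd S p) {i : ℕ} (hi : i < k) :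
    S i + #{p ∈ Finset.range N | Nat.count c p = i} = S (i + 1) := by
  classical
  have hcount {p : ℕ} (hp : p ≤ S k) : Nat.count c p = Nat.count (IsBlockEnd S) p := by
    simp only [Nat.count_eq_card_filter_range]
    refine congrArg Finset.card (Finset.filter_congr fun q hq => hpattern q ?_)
    exact (Finset.mem_range.1 hq).trans_le hp
  have hlt {j p : ℕ} (hj : j ≤ k) : Nat.count c p < j ↔ p < S j := by
    rcases le_total p (S k) with hp | hp
    · rw [hcount hp, count_isBlockEnd_lt_iff hS hS0]
    · have hk : ¬ Nat.count c p < k := by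
        have hmono := Nat.count_monotone c hp
        rw [hcount le_rfl] at hmono
        have := (count_isBlockEnd_lt_iff hS hS0 (j := k) (p := S k)).not.2 (lt_irrefl _)
        omega
      have := hS.monotone hj
      omega
  have hblock : {p ∈ Finset.range N | Nat.count c p = i} = Finset.Ico (S i) (S (i + 1)) := by
    ext p
    have hle : S (i + 1) ≤ S k := hS.monotone hi
    have hlow := hlt (p := p) hi.le
    have hhigh := hlt (j := i + 1) (p := p) hi
    simp only [Finset.mem_filter, Finset.mem_range, Finset.mem_Ico]
    omega
  rw [hblock, Nat.card_Ico]
  have : S i < S (i + 1) := hS (Nat.lt_add_one i)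
  omega

lemma card_count_eq_iff_isBlockEnd (hS : StrictMono S) (hS0 : S 0 = 0) (hN : S k < N) :
    (∀ i < k, S i + #{p ∈ Finset.range N | Nat.count c p = i} = S (i + 1)) ↔
      ∀ p < S k, c p ↔ IsBlockEnd S p :=
  ⟨fun h _ => iff_isBlockEnd_of_card_count_eq hS hS0 hN h,
    fun h _ => card_count_eq_of_iff_isBlockEnd hS hS0 hN.le h⟩

end IsBlockEnd

lemma lintegral_Ici_two_mul_add_mul_exp_neg_sq {a : ℝ} (ha : 0 ≤ a) :
    ∫⁻ x in Set.Ici 0, ENNReal.ofReal (2 * (a + x) * Real.exp (-(a + x) ^ 2)) =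
      ENNReal.ofReal (Real.exp (-a ^ 2)) := by
  have hderiv (x : ℝ) : HasDerivAt (fun x => -Real.exp (-(a + x) ^ 2))
      (2 * (a + x) * Real.exp (-(a + x) ^ 2)) x := by
    have hexp := (((hasDerivAt_id x).const_add a).fun_pow 2).fun_neg.exp.fun_neg
    refine hexp.congr_deriv ?_
    simp only [id]
    ring
  have hpos : ∀ x ∈ Set.Ioi (0 : ℝ), 0 ≤ 2 * (a + x) * Real.exp (-(a + x) ^ 2) := by
    intro x (hx : 0 < x)
    positivity
  have hlim : Tendsto (fun x => -Real.exp (-(a + x) ^ 2)) atTop (𝓝 0) := by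
    rw [← neg_zero]
    refine (Real.tendsto_exp_atBot.comp (tendsto_neg_atTop_atBot.comp ?_)).neg
    exact (tendsto_pow_atTop two_ne_zero).comp (tendsto_atTop_add_const_left _ _ tendsto_id)
  rw [setLIntegral_congr Ioi_ae_eq_Ici.symm, ← ofReal_integral_eq_lintegral_ofReal
    (integrableOn_Ioi_deriv_of_nonneg' (fun x _ => hderiv x) hpos hlim)
    ((ae_restrict_iff' measurableSet_Ioi).2 (ae_of_all _ hpos)),
    integral_Ioi_of_hasDerivAt_of_nonneg' (fun x _ => hderiv x) hpos hlim]
  simp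

namespace MemoryGame

/-- A permutation of the `2n` cards, without the condition on the colours that makes it a game:
`σ p` is the card at position `p`. -/
abbrev Arrangement (n : ℕ) : Type := Fin (2 * n) ≃ Card n

variable {n : ℕ}

/-- The position, in an arrangement of the cards, of the other card of the pair found at
position `p`. -/
def mate (σ : Arrangement n) (p : Fin (2 * n)) : Fin (2 * n) :=
  σ.symm ((σ p).1, !(σ p).2)

lemma mate_involutive (σ : Arrangement n) : (mate σ).Involutive := fun p => by simp [mate]

lemma mate_ne (σ : Arrangement n) (p : Fin (2 * n)) : mate σ p ≠ p := by
  rw [mate, Ne, Equiv.symm_apply_eq, Prod.ext_iff]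
  simp

lemma mate_trans (π : Equiv.Perm (Fin (2 * n))) (σ : Arrangement n) (p : Fin (2 * n)) :
    mate (π.trans σ) p = π.symm (mate σ (π p)) := rfl

/-- Position `p` of an arrangement holds the second card of its pair. In a game these are the red
cards. The position is a natural number so that `Nat.count` and `Nat.nth` apply; no position
`p ≥ 2n` completes a pair. -/
def Completes (σ : Arrangement n) (p : ℕ) : Prop :=
  ∃ hp : p < 2 * n, mate σ ⟨p, hp⟩ < ⟨p, hp⟩

instance (σ : Arrangement n) : DecidablePred (Completes σ) := fun p =>
  inferInstanceAs (Decidable (∃ hp : p < 2 * n, mate σ ⟨p, hp⟩ < ⟨p, hp⟩))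

lemma completes_val {σ : Arrangement n} {p : Fin (2 * n)} :
    Completes σ p ↔ mate σ p < p := by
  simp [Completes]

lemma completes_swap_trans {σ : Arrangement n} {a b t : Fin (2 * n)} (ha : t ≤ a) (hb : t ≤ b)
    {p : Fin (2 * n)} (hp : p < t) : Completes ((Equiv.swap a b).trans σ) p ↔ Completes σ p := by
  rw [completes_val, completes_val, mate_trans, Equiv.symm_swap,
    Equiv.swap_apply_of_ne_of_ne (hp.trans_le ha).ne (hp.trans_le hb).ne,
    swap_apply_lt_iff (hp.le.trans ha) (hp.le.trans hb)]

section Pattern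

variable {c : ℕ → Prop} [DecidablePred c] {t : ℕ}

/-- The arrangements in which, among the first `t` positions, exactly those satisfying `c` complete
a pair. For a game, this prescribes the colours of the first `t` cards. -/
def withPattern (n : ℕ) (c : ℕ → Prop) [DecidablePred c] (t : ℕ) : Finset (Arrangement n) :=
  {σ | ∀ p < t, Completes σ p ↔ c p}

lemma mem_withPattern {σ : Arrangement n} :
    σ ∈ withPattern n c t ↔ ∀ p < t, Completes σ p ↔ c p := by
  simp [withPattern]

lemma card_mate_lt_eq {a b t : Fin (2 * n)} (ha : t ≤ a) (hb : t ≤ b) :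
    #{σ ∈ withPattern n c t | mate σ a < t} = #{σ ∈ withPattern n c t | mate σ b < t} := by
  refine Finset.card_equiv (Equiv.equivCongr (Equiv.swap a b) (.refl _)) fun σ => ?_
  change _ ↔ (Equiv.swap a b).trans σ ∈ _
  have hpattern : (Equiv.swap a b).trans σ ∈ withPattern n c t ↔ σ ∈ withPattern n c t := by
    simp only [mem_withPattern]
    refine forall₂_congr fun p hp => ?_
    rw [completes_swap_trans ha hb (p := ⟨p, hp.trans t.2⟩) hp]
  rw [Finset.mem_filter, Finset.mem_filter, hpattern, mate_trans, Equiv.swap_apply_right,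
    Equiv.symm_swap, swap_apply_lt_iff ha hb]

lemma card_crossing_of_mem_withPattern {t : Fin (2 * n)} {σ : Arrangement n}
    (hσ : σ ∈ withPattern n c t) :
    #{s ∈ Finset.Ici t | mate σ s < t} + 2 * Nat.count c t = t := by
  have hcount : #{z ∈ Finset.Iio t | mate σ z < z} = Nat.count c t := by
    rw [← card_filter_Iio_val c]
    refine congrArg Finset.card (Finset.filter_congr fun z hz => ?_)
    have hzt : z < t := Finset.mem_Iio.1 hz
    rw [← completes_val, mem_withPattern.1 hσ z hzt]
  rw [← hcount, card_crossing_add_two_mul (mate_involutive σ) (mate_ne σ), Fin.card_Iio]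

/-- The partners of the `t - 2 * Nat.count c t` cards left open by the first `t` positions are
exchangeable over the remaining `2n - t` positions. -/
lemma card_completes_mul (t : Fin (2 * n)) :
    (#{σ ∈ withPattern n c t | Completes σ t} : ℝ) * (2 * n - t) =
      #(withPattern n c t) * (t - 2 * Nat.count c t) := by
  have hdouble : #(withPattern n c t) * (t - 2 * Nat.count c t) =
      #(Finset.Ici t) * #{σ ∈ withPattern n c t | mate σ t < t} := by
    refine Finset.card_mul_eq_card_mul (fun σ s => mate σ s < t) (fun σ hσ => ?_) fun s hs => ?_
    · exact Nat.eq_sub_of_add_eq (card_crossing_of_mem_withPattern hσ)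
    · exact card_mate_lt_eq (Finset.mem_Ici.1 hs) le_rfl
  rcases (withPattern n c t).eq_empty_or_nonempty with hempty | ⟨σ, hσ⟩
  · simp [hempty]
  have hle : 2 * Nat.count c t ≤ t := by
    have := card_crossing_of_mem_withPattern hσ
    omega
  have hcast := congrArg (Nat.cast (R := ℝ)) hdouble
  push_cast [hle, Fin.card_Ici, t.2.le] at hcast
  simp only [completes_val]
  rw [hcast, mul_comm]

lemma withPattern_succ (t : ℕ) :
    withPattern n c (t + 1) = {σ ∈ withPattern n c t | Completes σ t ↔ c t} := by
  ext σ
  simp only [mem_withPattern, Finset.mem_filter]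
  exact Nat.forall_lt_succ_right

lemma card_withPattern_succ_of (ht : t < 2 * n) (hc : c t) :
    (#(withPattern n c (t + 1)) : ℝ) * (2 * n - t) =
      #(withPattern n c t) * (t - 2 * Nat.count c t) := by
  rw [← card_completes_mul ⟨t, ht⟩, withPattern_succ]
  simp only [hc, iff_true]

lemma card_withPattern_succ_of_not (ht : t < 2 * n) (hc : ¬ c t) :
    (#(withPattern n c (t + 1)) : ℝ) * (2 * n - t) =
      #(withPattern n c t) * (2 * (n - (t - Nat.count c t))) := by
  have hsplit := Finset.card_filter_add_card_filter_not (s := withPattern n c t)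
    fun σ => Completes σ t
  have hcast := congrArg (Nat.cast (R := ℝ)) hsplit
  push_cast at hcast
  have hcompletes := card_completes_mul (c := c) ⟨t, ht⟩
  simp only [withPattern_succ, hc, iff_false]
  linear_combination (2 * n - t : ℝ) * hcast - hcompletes

/-- The `i`-th completing position has `Nat.nth c i - 2 * i` open cards to choose its mate from; the
first card of the `(b + 1)`-st pair is one of `2 * (n - b)`. -/
lemma card_withPattern (c : ℕ → Prop) [DecidablePred c] (ht : t ≤ 2 * n) :
    (#(withPattern n c t) : ℝ) * (2 * n).descFactorial t =
      Fintype.card (Arrangement n) *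
        (∏ i ∈ Finset.range (Nat.count c t), (Nat.nth c i - 2 * i : ℝ)) *
        (2 ^ (t - Nat.count c t) * n.descFactorial (t - Nat.count c t)) := by
  induction t with
  | zero => simp [withPattern]
  | succ t ih =>
    specialize ih (by omega)
    rw [cast_descFactorial_succ, Nat.count_succ]
    push_cast
    by_cases hc : c t
    · have hstep := card_withPattern_succ_of ht hc
      rw [if_pos hc, Nat.add_sub_add_right, Finset.prod_range_succ, Nat.nth_count hc]
      linear_combination ((2 * n).descFactorial t : ℝ) * hstep + (t - 2 * Nat.count c t : ℝ) * ih
    · have hstep := card_withPattern_succ_of_not ht hc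
      have hle := Nat.count_le (p := c) (n := t)
      rw [if_neg hc, add_zero, Nat.sub_add_comm hle, cast_descFactorial_succ, pow_succ,
        Nat.cast_sub hle]
      linear_combination ((2 * n).descFactorial t : ℝ) * hstep +
        2 * (n - (t - Nat.count c t) : ℝ) * ih

end Pattern

/-- The arrangement with the colours exchanged within the pairs selected by `ε`. -/
def recolour (ε : Fin n → Bool) (σ : Arrangement n) : Arrangement n :=
  σ.trans (Function.Involutive.toPerm (fun x => (x.1, xor x.2 (ε x.1))) fun x => by simp)

lemma recolour_apply (ε : Fin n → Bool) (σ : Arrangement n) (p : Fin (2 * n)) :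
    recolour ε σ p = ((σ p).1, xor (σ p).2 (ε (σ p).1)) := rfl

lemma recolour_recolour (ε : Fin n → Bool) (σ : Arrangement n) : recolour ε (recolour ε σ) = σ := by
  ext p <;> simp [recolour_apply]

lemma recolour_symm_apply (ε : Fin n → Bool) (σ : Arrangement n) (x : Card n) :
    (recolour ε σ).symm x = σ.symm (x.1, xor x.2 (ε x.1)) := rfl

lemma mate_recolour (ε : Fin n → Bool) (σ : Arrangement n) : mate (recolour ε σ) = mate σ := by
  ext p
  simp [mate, recolour_symm_apply, recolour_apply]

/-- The labels whose red card precedes the blue one. -/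
def redFirst (σ : Arrangement n) (a : Fin n) : Bool :=
  decide (σ.symm (a, true) < σ.symm (a, false))

lemma recolour_redFirst_lt (σ : Arrangement n) (a : Fin n) :
    (recolour (redFirst σ) σ).symm (a, false) < (recolour (redFirst σ) σ).symm (a, true) := by
  rw [recolour_symm_apply, recolour_symm_apply]
  by_cases h : σ.symm (a, true) < σ.symm (a, false)
  · simp [redFirst, h]
  · have hne : σ.symm (a, false) ≠ σ.symm (a, true) := by simp
    simpa [redFirst, h] using hne.lt_of_le (not_lt.1 h)

lemma redFirst_recolour (ε : Fin n → Bool) (σ : Deal n) : redFirst (recolour ε σ.1) = ε := by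
  ext a
  have h := σ.2 a
  cases hε : ε a <;> simp [redFirst, recolour_symm_apply, hε, h, h.le]

/-- An arrangement is a game together with the choice of the pairs whose colours are exchanged. -/
def arrangementEquiv (n : ℕ) : Deal n × (Fin n → Bool) ≃ Arrangement n where
  toFun x := recolour x.2 x.1.1
  invFun σ := (⟨recolour (redFirst σ) σ, recolour_redFirst_lt σ⟩, redFirst σ)
  left_inv x := by
    refine Prod.ext (Subtype.ext ?_) (redFirst_recolour x.2 x.1)
    simp only [redFirst_recolour, recolour_recolour]
  right_inv σ := recolour_recolour _ σ

lemma completes_recolour (ε : Fin n → Bool) (σ : Arrangement n) (p : ℕ) :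
    Completes (recolour ε σ) p ↔ Completes σ p := by
  rw [Completes, Completes, mate_recolour]

lemma randomGame_real_pattern (c : ℕ → Prop) [DecidablePred c] (t : ℕ) :
    (randomGame n).real {σ | ∀ p < t, Completes σ.1 p ↔ c p} =
      #(withPattern n c t) / Fintype.card (Arrangement n) := by
  have hall : Fintype.card (Arrangement n) =
      Fintype.card (Deal n) * Fintype.card (Fin n → Bool) := by
    rw [← Fintype.card_prod, Fintype.card_congr (arrangementEquiv n)]
  have hpattern : #(withPattern n c t) =
      #{σ : Deal n | ∀ p < t, Completes σ.1 p ↔ c p} * Fintype.card (Fin n → Bool) := by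
    rw [← Finset.card_univ (α := Fin n → Bool), ← Finset.card_product]
    refine (Finset.card_equiv (arrangementEquiv n) fun x => ?_).symm
    simp [mem_withPattern, arrangementEquiv, completes_recolour]
  rw [hall, hpattern, measureReal_def, randomGame,
    PMF.toMeasure_uniformOfFintype_apply _ MeasurableSpace.measurableSet_top, ENNReal.toReal_div,
    ENNReal.toReal_natCast, ENNReal.toReal_natCast, Nat.cast_mul, Nat.cast_mul,
    mul_div_mul_right _ _ (by positivity), ← Set.toFinset_card, Set.toFinset_ofPred]

lemma completes_iff_isRed (σ : Deal n) (p : Fin (2 * n)) : Completes σ.1 p ↔ σ.IsRed p := by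
  rw [completes_val]
  obtain ⟨σ, hσ⟩ := σ
  obtain ⟨⟨a, b⟩, rfl⟩ := σ.symm.surjective p
  cases b
  · simpa [Deal.IsRed, mate] using (hσ a).le
  · simpa [Deal.IsRed, mate] using hσ a

lemma blockLength_eq_card_count (σ : Deal n) (i : ℕ) :
    σ.blockLength i = #{p ∈ Finset.range (2 * n) | Nat.count (Completes σ.1) p = i} := by
  rw [← card_filter_univ_val]
  refine congrArg Finset.card (Finset.filter_congr fun p _ => ?_)
  rw [← card_filter_Iio_val]
  refine Eq.congr_left (congrArg Finset.card ?_)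
  ext q
  simp [completes_iff_isRed]

theorem randomGame_real_blockLength {S : ℕ → ℕ} (hS : StrictMono S) (hS0 : S 0 = 0) {k : ℕ}
    (hk : S k < 2 * n) :
    (randomGame n).real {σ | ∀ i < k, S i + σ.blockLength i = S (i + 1)} =
      (∏ i ∈ Finset.range k, (S (i + 1) - (2 * i + 1) : ℝ)) *
        (2 ^ (S k - k) * n.descFactorial (S k - k)) / (2 * n).descFactorial (S k) := by
  classical
  have hevent : {σ : Deal n | ∀ i < k, S i + σ.blockLength i = S (i + 1)} =
      {σ | ∀ p < S k, Completes σ.1 p ↔ IsBlockEnd S p} := by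
    ext σ
    simp only [blockLength_eq_card_count]
    exact card_count_eq_iff_isBlockEnd hS hS0 hk
  have hcount : Nat.count (IsBlockEnd S) (S k) = k :=
    count_isBlockEnd_eq hS hS0 le_rfl (hS (Nat.lt_add_one k))
  have hnth (i : ℕ) : (Nat.nth (IsBlockEnd S) i - 2 * i : ℝ) = S (i + 1) - (2 * i + 1) := by
    rw [← nth_isBlockEnd hS hS0]
    push_cast
    ring
  have hpos : (0 : ℝ) < Fintype.card (Arrangement n) := by
    have : Nonempty (Arrangement n) := ⟨(Classical.arbitrary (Deal n)).1⟩
    exact_mod_cast Fintype.card_pos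
  have hdesc : ((2 * n).descFactorial (S k) : ℝ) ≠ 0 := by
    exact_mod_cast (Nat.descFactorial_pos.2 hk.le).ne'
  have hcard := card_withPattern (IsBlockEnd S) hk.le
  simp only [hcount, hnth] at hcard
  rw [hevent, randomGame_real_pattern, div_eq_div_iff hpos.ne' hdesc, hcard]
  ring

section Asymptotics

variable {x : ℝ} {s : ℕ → ℕ}

lemma tendsto_sub_const_div_sqrt (hs : Tendsto (fun n : ℕ => (s n : ℝ) / √(n : ℝ)) atTop (𝓝 x))
    (c : ℝ) : Tendsto (fun n : ℕ => (s n - c) / √(n : ℝ)) atTop (𝓝 x) := by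
  simpa only [sub_div, sub_zero, id] using
    hs.sub ((tendsto_sqrt_natCast_atTop tendsto_id).const_div_atTop c)

/-- The probability that the `s n - k` blue cards among the first `s n` cards have different labels,
relative to the probability that the first `s n` cards are distinct, in sampling with
replacement. -/
lemma tendsto_descFactorial_ratio {k : ℕ} (hk : ∀ᶠ n in atTop, k ≤ s n)
    (hs : Tendsto (fun n : ℕ => (s n : ℝ) / √(n : ℝ)) atTop (𝓝 (2 * x))) :
    Tendsto (fun n : ℕ => ((n.descFactorial (s n - k) : ℝ) / (n : ℝ) ^ (s n - k)) /
      ((2 * n).descFactorial (s n) / ((2 * n : ℕ) : ℝ) ^ s n)) atTop (𝓝 (Real.exp (-x ^ 2))) := by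
  have hblue : Tendsto (fun n : ℕ => ((s n - k : ℕ) : ℝ) / √(n : ℝ)) atTop (𝓝 (2 * x)) := by
    refine (tendsto_sub_const_div_sqrt hs k).congr' ?_
    filter_upwards [hk] with n hn
    rw [Nat.cast_sub hn]
  have hall : Tendsto (fun n : ℕ => (s n : ℝ) / √((2 * n : ℕ) : ℝ)) atTop (𝓝 (2 * x / √2)) := by
    refine (hs.div_const √2).congr fun n => ?_
    rw [Nat.cast_mul, Nat.cast_ofNat, Real.sqrt_mul zero_le_two, div_div, mul_comm]
  have hdouble : Tendsto (fun n : ℕ => 2 * n) atTop atTop := tendsto_id.const_mul_atTop' two_pos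
  have hexp : Real.exp (-x ^ 2) =
      Real.exp (-((2 * x) ^ 2 / 2)) / Real.exp (-((2 * x / √2) ^ 2 / 2)) := by
    rw [← Real.exp_sub, div_pow, Real.sq_sqrt zero_le_two]
    ring_nf
  rw [hexp]
  exact (tendsto_descFactorial_div_pow tendsto_id hblue).div
    (tendsto_descFactorial_div_pow hdouble hall) (Real.exp_ne_zero _)

end Asymptotics

theorem tendsto_randomGame_real_blockLength {k : ℕ} {S : ℕ → ℕ → ℕ} {X : ℕ → ℝ}
    (hS : ∀ᶠ n in atTop, StrictMono (S n)) (hS0 : ∀ n, S n 0 = 0)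
    (hX : ∀ j, Tendsto (fun n : ℕ => (S n j : ℝ) / √(n : ℝ)) atTop (𝓝 (2 * X j))) :
    Tendsto (fun n : ℕ => (2 * √(n : ℝ)) ^ k *
        (randomGame n).real {σ | ∀ i < k, S n i + σ.blockLength i = S n (i + 1)}) atTop
      (𝓝 ((∏ i ∈ Finset.range k, 2 * X (i + 1)) * Real.exp (-X k ^ 2))) := by
  have hk : ∀ᶠ n in atTop, k ≤ S n k := hS.mono fun n hn => hn.le_apply
  have hred := tendsto_finsetProd (Finset.range k) fun i _ =>
    tendsto_sub_const_div_sqrt (hX (i + 1)) (2 * i + 1)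
  refine (hred.mul (tendsto_descFactorial_ratio hk (hX k))).congr' ?_
  filter_upwards [hS, hk, eventually_lt_of_tendsto_div_sqrt tendsto_id (hX k),
    eventually_gt_atTop 0] with n hSn hkn hltn hn
  have hsqrt : √(n : ℝ) ^ k * √(n : ℝ) ^ k = n ^ k := by
    rw [← mul_pow, Real.mul_self_sqrt n.cast_nonneg]
  have hltn' : S n k < 2 * n := by
    simp only [id] at hltn
    omega
  obtain ⟨b, hb⟩ := Nat.exists_eq_add_of_le hkn
  rw [randomGame_real_blockLength hSn (hS0 n) hltn', Finset.prod_div_distrib, Finset.prod_const,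
    Finset.card_range, hb, Nat.add_sub_cancel_left]
  have : 0 < √(n : ℝ) := by positivity
  push_cast
  field_simp
  rw [pow_add, mul_pow 2 (n : ℝ) k, ← hsqrt]
  ring

section LimitLaw

variable {k : ℕ}

lemma measurable_limitDensity : Measurable (limitDensity k) := by
  have horthant : MeasurableSet {x : Fin k → ℝ | ∀ i, 0 ≤ x i} := measurableSet_Ici (a := 0)
  exact Measurable.ite horthant (by fun_prop) measurable_const

lemma limitDensity_snoc (y : Fin k → ℝ) (a : ℝ) :
    limitDensity (k + 1) (Fin.snoc y a) =
      if (∀ i, 0 ≤ y i) ∧ 0 ≤ a then (2 ^ k * ∏ i : Fin k, ∑ j ∈ Finset.Iic i, y j) *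
        (2 * ((∑ j, y j) + a) * Real.exp (-((∑ j, y j) + a) ^ 2)) else 0 := by
  have hnonneg : (∀ i, (0 : ℝ) ≤ (Fin.snoc y a : Fin (k + 1) → ℝ) i) ↔
      (∀ i, 0 ≤ y i) ∧ 0 ≤ a := by
    simp [Fin.forall_fin_succ']
  have hsum (i : Fin k) : ∑ j ∈ Finset.Iic i.castSucc, (Fin.snoc y a : Fin (k + 1) → ℝ) j =
      ∑ j ∈ Finset.Iic i, y j := by
    simp [← Fin.map_castSuccEmb_Iic]
  have hlast : Finset.Iic (Fin.last k) = Finset.univ := Finset.Iic_top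
  simp only [limitDensity, hnonneg, Fin.prod_univ_castSucc, hsum, hlast, Fin.sum_univ_castSucc,
    Fin.snoc_castSucc, Fin.snoc_last]
  split_ifs
  · ring
  · rfl

lemma lintegral_limitDensity_snoc (y : Fin k → ℝ) :
    ∫⁻ a, ENNReal.ofReal (limitDensity (k + 1) (Fin.snoc y a)) =
      ENNReal.ofReal (limitDensity k y) := by
  simp only [limitDensity_snoc]
  by_cases hy : ∀ i, 0 ≤ y i
  swap
  · simp [limitDensity, hy]
  set A := 2 ^ k * ∏ i : Fin k, ∑ j ∈ Finset.Iic i, y j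
  set t := ∑ j, y j
  have hA : 0 ≤ A := mul_nonneg (by positivity)
    (Finset.prod_nonneg fun i _ => Finset.sum_nonneg fun j _ => hy j)
  have hind (a : ℝ) : ENNReal.ofReal (if (∀ i, 0 ≤ y i) ∧ 0 ≤ a then
      A * (2 * (t + a) * Real.exp (-(t + a) ^ 2)) else 0) = (Set.Ici 0).indicator
        (fun a => ENNReal.ofReal A * ENNReal.ofReal (2 * (t + a) * Real.exp (-(t + a) ^ 2))) a := by
    by_cases ha : 0 ≤ a <;> simp [hy, ha, ENNReal.ofReal_mul hA]
  simp only [hind]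
  rw [lintegral_indicator measurableSet_Ici, lintegral_const_mul _ (by fun_prop),
    lintegral_Ici_two_mul_add_mul_exp_neg_sq (Finset.sum_nonneg fun j _ => hy j),
    ← ENNReal.ofReal_mul hA, limitDensity, if_pos hy]

lemma lintegral_limitDensity : ∫⁻ x, ENNReal.ofReal (limitDensity k x) = 1 := by
  induction k with
  | zero =>
    rw [volume_pi, Measure.pi_of_empty (x := isEmptyElim), lintegral_dirac]
    simp [limitDensity]
  | succ k ih =>
    let e := (MeasurableEquiv.piFinSuccAbove (fun _ : Fin (k + 1) => ℝ) (Fin.last k)).symm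
    have he : MeasurePreserving e :=
      (volume_preserving_piFinSuccAbove (fun _ : Fin (k + 1) => ℝ) (Fin.last k)).symm
    have hmeas : Measurable fun z => ENNReal.ofReal (limitDensity (k + 1) (e z)) :=
      measurable_limitDensity.ennreal_ofReal.comp e.measurable
    have hsnoc (a : ℝ) (y : Fin k → ℝ) : e (a, y) = Fin.snoc y a := Fin.insertNth_last' a y
    calc _ = ∫⁻ z, ENNReal.ofReal (limitDensity (k + 1) (e z)) :=
          (he.lintegral_comp_emb e.measurableEmbedding _).symm
      _ = ∫⁻ y : Fin k → ℝ, ∫⁻ a : ℝ, ENNReal.ofReal (limitDensity (k + 1) (e (a, y))) :=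
          lintegral_prod_symm' _ hmeas
      _ = ∫⁻ y, ENNReal.ofReal (limitDensity k y) := by
          simp only [hsnoc, lintegral_limitDensity_snoc]
      _ = 1 := ih

lemma isProbabilityMeasure_limitLaw : IsProbabilityMeasure (limitLaw k) :=
  ⟨by rw [limitLaw, withDensity_apply _ .univ, setLIntegral_univ, lintegral_limitDensity]⟩

lemma limitDensity_eq_prod_partialSums {x : Fin k → ℝ} (hx : ∀ i, 0 ≤ x i) {X : ℕ → ℝ}
    (hX : ∀ j, X j = ∑ i ∈ Finset.range j, Function.extend Fin.val x 0 i) :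
    limitDensity k x = (∏ i ∈ Finset.range k, 2 * X (i + 1)) * Real.exp (-X k ^ 2) := by
  have hsum (i : Fin k) : X (i + 1) = ∑ j ∈ Finset.Iic i, x j := by
    rw [hX, Nat.range_succ_eq_Iic, ← Fin.map_valEmbedding_Iic, Finset.sum_map]
    simp [Fin.val_injective.extend_apply]
  have htotal : X k = ∑ j, x j := by
    simp [hX, Finset.sum_range, Fin.val_injective.extend_apply]
  simp only [limitDensity, if_pos hx, Finset.prod_mul_distrib, Finset.prod_const,
    Finset.card_range, Finset.prod_range, hsum, htotal]

end LimitLaw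

section LocalLimit

variable {k : ℕ} {x : Fin k → ℝ}

lemma tendsto_two_mul_sqrt_natCast_atTop : Tendsto (fun n : ℕ => 2 * √(n : ℝ)) atTop atTop :=
  (tendsto_sqrt_natCast_atTop tendsto_id).const_mul_atTop two_pos

/-- The lengths of all blocks when those of the first `k` are given by the cell of the lattice
`(2√n)⁻¹ ℤᵏ` that contains `x`. The value `1` beyond the first `k` blocks serves only to
make the partial sums strictly increasing. -/
noncomputable def cellLengths (x : Fin k → ℝ) (n : ℕ) : ℕ → ℕ :=
  Function.extend Fin.val (fun i => ⌊2 * √(n : ℝ) * x i⌋₊) 1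

lemma cellLengths_val (x : Fin k → ℝ) (n : ℕ) (i : Fin k) :
    cellLengths x n i = ⌊2 * √(n : ℝ) * x i⌋₊ :=
  Fin.val_injective.extend_apply _ _ i

lemma cellLengths_of_le (x : Fin k → ℝ) (n : ℕ) {i : ℕ} (hi : k ≤ i) : cellLengths x n i = 1 :=
  extend_val_of_le _ _ hi

lemma eventually_cellLengths_pos (hx : ∀ i, 0 < x i) :
    ∀ᶠ n in atTop, ∀ i, 0 < cellLengths x n i := by
  have hfloor : ∀ᶠ n : ℕ in atTop, ∀ i, 1 ≤ 2 * √(n : ℝ) * x i := eventually_all.2 fun i =>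
    (tendsto_two_mul_sqrt_natCast_atTop.atTop_mul_const (hx i)).eventually_ge_atTop 1
  filter_upwards [hfloor] with n hn i
  rcases lt_or_ge i k with hi | hi
  · lift i to Fin k using hi
    rw [cellLengths_val]
    exact Nat.floor_pos.2 (hn i)
  · simp [cellLengths_of_le x n hi]

lemma tendsto_cellLengths_div_sqrt (hx : ∀ i, 0 ≤ x i) (i : ℕ) :
    Tendsto (fun n : ℕ => (cellLengths x n i : ℝ) / √(n : ℝ)) atTop
      (𝓝 (2 * Function.extend Fin.val x 0 i)) := by
  have hsqrt := tendsto_sqrt_natCast_atTop tendsto_id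
  rcases lt_or_ge i k with hi | hi
  · lift i to Fin k using hi
    rw [Fin.val_injective.extend_apply]
    refine ((tendsto_nat_floor_mul_div_atTop (mul_nonneg zero_le_two (hx i))).comp hsqrt).congr
      fun n => ?_
    simp only [cellLengths_val, Function.comp_apply, id, mul_right_comm]
  · rw [extend_val_of_le _ _ hi]
    simpa [cellLengths_of_le x _ hi] using hsqrt.const_div_atTop 1

lemma tendsto_randomGame_real_cell_of_pos (hx : ∀ i, 0 < x i) :
    Tendsto (fun n : ℕ => (2 * √(n : ℝ)) ^ k * (randomGame n).real
      {σ | ∀ i : Fin k, (σ.blockLength i : ℤ) = ⌊2 * √(n : ℝ) * x i⌋}) atTop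
      (𝓝 (limitDensity k x)) := by
  let S (n j : ℕ) : ℕ := ∑ i ∈ Finset.range j, cellLengths x n i
  let X (j : ℕ) : ℝ := ∑ i ∈ Finset.range j, Function.extend Fin.val x 0 i
  have hS : ∀ᶠ n in atTop, StrictMono (S n) := by
    filter_upwards [eventually_cellLengths_pos hx] with n hn
    exact strictMono_nat_of_lt_succ fun j => by simp [S, Finset.sum_range_succ, hn]
  have hX (j : ℕ) : Tendsto (fun n : ℕ => (S n j : ℝ) / √(n : ℝ)) atTop (𝓝 (2 * X j)) := by
    simp only [S, X, Nat.cast_sum, Finset.sum_div, Finset.mul_sum]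
    exact tendsto_finsetSum _ fun i _ => tendsto_cellLengths_div_sqrt (fun i => (hx i).le) i
  have hcell (n : ℕ) :
      {σ : Deal n | ∀ i : Fin k, (σ.blockLength i : ℤ) = ⌊2 * √(n : ℝ) * x i⌋} =
        {σ | ∀ i < k, S n i + σ.blockLength i = S n (i + 1)} := by
    ext σ
    have hfloor (i : Fin k) : ⌊2 * √(n : ℝ) * x i⌋ = (cellLengths x n i : ℤ) := by
      have := (hx i).le
      rw [cellLengths_val, Int.natCast_floor_eq_floor (by positivity)]
    simp [S, Finset.sum_range_succ, hfloor, Fin.forall_iff]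
  rw [limitDensity_eq_prod_partialSums (fun i => (hx i).le) fun _ => rfl]
  simpa only [hcell] using tendsto_randomGame_real_blockLength hS (fun _ => rfl) hX

lemma tendsto_randomGame_real_cell_of_neg {i : Fin k} (hi : x i < 0) :
    Tendsto (fun n : ℕ => (2 * √(n : ℝ)) ^ k * (randomGame n).real
      {σ | ∀ i : Fin k, (σ.blockLength i : ℤ) = ⌊2 * √(n : ℝ) * x i⌋}) atTop
      (𝓝 (limitDensity k x)) := by
  rw [limitDensity, if_neg fun h => (h i).not_gt hi]
  refine tendsto_const_nhds.congr' ?_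
  filter_upwards [tendsto_two_mul_sqrt_natCast_atTop.eventually_gt_atTop 0] with n hn
  have hempty : {σ : Deal n | ∀ i : Fin k, (σ.blockLength i : ℤ) = ⌊2 * √(n : ℝ) * x i⌋} = ∅ :=
    Set.eq_empty_of_forall_notMem fun σ hσ => by
      have hneg : ⌊2 * √(n : ℝ) * x i⌋ < 0 := Int.floor_lt_zero.2 (mul_neg_of_pos_of_neg hn hi)
      have := hσ i
      omega
  rw [hempty, measureReal_empty, mul_zero]

theorem ae_tendsto_randomGame_real_cell (k : ℕ) :
    ∀ᵐ x : Fin k → ℝ, Tendsto (fun n : ℕ => (2 * √(n : ℝ)) ^ k * (randomGame n).real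
      {σ | ∀ i : Fin k, (σ.blockLength i : ℤ) = ⌊2 * √(n : ℝ) * x i⌋}) atTop
      (𝓝 (limitDensity k x)) := by
  have hne : ∀ᵐ x : Fin k → ℝ, ∀ i, x i ≠ 0 :=
    ae_all_iff.2 fun i => Measure.ae_eval_ne (μ := fun _ => volume) i 0
  filter_upwards [hne] with x hx
  by_cases hneg : ∃ i, x i < 0
  · obtain ⟨i, hi⟩ := hneg
    exact tendsto_randomGame_real_cell_of_neg hi
  · push Not at hneg
    exact tendsto_randomGame_real_cell_of_pos fun i => (hneg i).lt_of_ne' (hx i)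

end LocalLimit

end MemoryGame

theorem theorem2p5 (k : ℕ) (hk : 0 < k) :
    ∃ _ : IsProbabilityMeasure (MemoryGame.limitLaw k),
      TendstoInDistribution (fun n : ℕ => MemoryGame.scaledBlockLengths k n) atTop
        (id : (Fin k → ℝ) → (Fin k → ℝ)) MemoryGame.randomGame (MemoryGame.limitLaw k) := by
  have hprob : IsProbabilityMeasure (MemoryGame.limitLaw k) :=
    MemoryGame.isProbabilityMeasure_limitLaw
  have : IsProbabilityMeasure
    (volume.withDensity fun x => ENNReal.ofReal (MemoryGame.limitDensity k x)) := hprob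
  let D (n : ℕ) (σ : MemoryGame.Deal n) (i : Fin k) : ℤ := σ.blockLength i
  have hlocal : ∀ᵐ x, Tendsto (fun n : ℕ => (2 * √(n : ℝ)) ^ Fintype.card (Fin k) *
      (MemoryGame.randomGame n).real {σ | ∀ i, D n σ i = ⌊2 * √(n : ℝ) * x i⌋}) atTop
      (𝓝 (MemoryGame.limitDensity k x)) := by
    simpa only [Fintype.card_fin] using MemoryGame.ae_tendsto_randomGame_real_cell k
  exact ⟨hprob, tendstoInDistribution_of_local_limit (D := D) (fun n => measurable_from_top)
    MemoryGame.tendsto_two_mul_sqrt_natCast_atTop hlocal⟩
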